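/- Let $G$ be a countably infinite discrete group acting by homeomorphisms on a compact metric space $(X,d)$, let $\mu$ be a $G$-invariant Borel probability measure on $X$, and let $\{F_n\}_{n\in\mathbb N}$ be a Følner sequence of $G$, that is, a sequence of finite nonempty subsets of $G$ with $\lim_{n\to\infty}|gF_n\,\Delta\,F_n|/|F_n|=0$ for every $g\in G$ (in particular $G$ is amenable). We say that $\mu$ has discrete spectrum if the closed linear subspace of the complex Hilbert space $L^2(X,\mu)$ generated by all finite-dimensional subspaces that are invariant under $f\mapsto f\circ g$ for every $g\in G$ is all of $L^2(X,\mu)$. A semimetric on $X$ is a function $\rho:X\times X\to[0,\infty)$ with $\rho(x,x)=0$, $\rho(x,y)=\rho(y,x)$ and $\rho(x,z)\le\rho(x,y)+\rho(y,z)$ for all $x,y,z\in X$. It is continuous if the identity map $(X,d)\to(X,\rho)$ is continuous. A continuous metric is a continuous semimetric $\rho$ for which $\rho(x,y)=0$ implies $x=y$. For a semimetric $w$ on $X$, $n\in\mathbb N$ and $x,y\in X$, put $$\overline{w}_{F_n}(x,y)=\frac1{|F_n|}\sum_{g\in F_n}w(gx,gy),$$ and for $\varepsilon>0$ let $C(\overline{w}_{F_n},\varepsilon)$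 be the least $m$ for which there are $x_1,\dots,x_m\in X$ with $$\mu\Bigl(\bigcup_{i=1}^m\{y\in X:\overline{w}_{F_n}(x_i,y)<\varepsilon/2\}\Bigr)>1-\varepsilon .$$ We say that $\mu$ has bounded complexity with respect to $\{\overline{w}_{F_n}\}$ if for every $\varepsilon>0$ there is $M\in\mathbb N$ such that $C(\overline{w}_{F_n},\varepsilon)\le M$ for all $n\in\mathbb N$. Then the following statements are equivalent: 1. $\mu$ has discrete spectrum. 2. $\mu$ has bounded complexity with respect to $\{\overline{d'}_{F_n}\}$ for some continuous metric $d'$ on $X$. 3. $\mu$ has bounded complexity with respect to $\{\overline{\rho}_{F_n}\}$ for every continuous semimetric $\rho$ on $X$. 4. $\mu$ has bounded complexity with respect to $\{\overline{d}_{F_n}\}$ for the given metric $d$. -/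

import Mathlib

open MeasureTheory Filter Topology
open scoped Pointwise ENNReal symmDiff

noncomputable section

/-- A (left) Følner sequence of a discrete group `G`: finite nonempty sets `F n` with
`|g F_n ∆ F_n| / |F_n| → 0` for every `g`. The existence of one is the amenability of `G`. -/
structure IsFolnerSequence {G : Type*} [Group G] (F : ℕ → Finset G) : Prop where
  nonempty : ∀ n, (F n).Nonempty
  tendsto : ∀ g : G, Tendsto
    (fun n => ((((g • (F n : Set G)) ∆ (F n : Set G)).ncard : ℝ) / ((F n).card : ℝ)))
    atTop (𝓝 0)

/-- The Koopman operator `f ↦ f ∘ g` on `L²(X, μ)` (complex-valued functions). -/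
def koopman {G X : Type*} [Group G] [MulAction G X] [MeasurableSpace X]
    [MeasurableConstSMul G X] (μ : Measure X) [SMulInvariantMeasure G X μ] (g : G) :
    Lp ℂ 2 μ →ₗ[ℂ] Lp ℂ 2 μ :=
  Lp.compMeasurePreservingₗ ℂ (fun x : X => g • x) (measurePreserving_smul g μ)

/-- The closed linear subspace `H_c` of `L²(X, μ)` generated by all finite-dimensional
`G`-invariant linear subspaces. -/
def discreteSpectrumSubspace (G : Type*) {X : Type*} [Group G] [MulAction G X]
    [MeasurableSpace X] [MeasurableConstSMul G X] (μ : Measure X)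
    [SMulInvariantMeasure G X μ] : Submodule ℂ (Lp ℂ 2 μ) :=
  (sSup {V : Submodule ℂ (Lp ℂ 2 μ) |
    FiniteDimensional ℂ V ∧ ∀ g : G, ∀ f ∈ V, koopman μ g f ∈ V}).topologicalClosure

/-- `μ` has discrete spectrum: `H_c = L²(X, μ)`. -/
def HasDiscreteSpectrum (G : Type*) {X : Type*} [Group G] [MulAction G X]
    [MeasurableSpace X] [MeasurableConstSMul G X] (μ : Measure X)
    [SMulInvariantMeasure G X μ] : Prop :=
  discreteSpectrumSubspace G μ = ⊤

/-- A semimetric on `X`. -/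
structure IsSemimetric {X : Type*} (ρ : X → X → ℝ) : Prop where
  nonneg : ∀ x y, 0 ≤ ρ x y
  self : ∀ x, ρ x x = 0
  symm : ∀ x y, ρ x y = ρ y x
  triangle : ∀ x y z, ρ x z ≤ ρ x y + ρ y z

/-- The space `(X, ρ)`, with the topology given by the `ρ`-balls. -/
abbrev IsSemimetric.toPseudoMetricSpace {X : Type*} {ρ : X → X → ℝ} (h : IsSemimetric ρ) :
    PseudoMetricSpace X where
  dist := ρ
  dist_self := h.self
  dist_comm := h.symm
  dist_triangle := h.triangle

/-- A continuous semimetric on a topological space `X`: a semimetric `ρ` for which the identity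
map from `X` to `(X, ρ)` is continuous. -/
def IsContinuousSemimetric {X : Type*} [t : TopologicalSpace X] (ρ : X → X → ℝ) : Prop :=
  ∃ h : IsSemimetric ρ,
    @Continuous X X t h.toPseudoMetricSpace.toUniformSpace.toTopologicalSpace id

/-- A continuous metric: a continuous semimetric that separates points. -/
def IsContinuousMetric {X : Type*} [TopologicalSpace X] (ρ : X → X → ℝ) : Prop :=
  IsContinuousSemimetric ρ ∧ ∀ x y, ρ x y = 0 → x = y

/-- The average `w̄_F(x, y) = (1 / |F|) ∑_{g ∈ F} w(g x, g y)`. -/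
def averageSemimetric {G X : Type*} [Group G] [MulAction G X] (w : X → X → ℝ) (F : Finset G)
    (x y : X) : ℝ :=
  (1 / (F.card : ℝ)) * ∑ g ∈ F, w (g • x) (g • y)

/-- The complexity `C(v, ε)`: the least `m` for which there are `x₁, …, x_m` such that the open
`v`-balls of radius `ε / 2` about them have a union of measure greater than `1 - ε`
(and `⊤` if there is no such `m`). -/
def complexity {X : Type*} [MeasurableSpace X] (μ : Measure X) (v : X → X → ℝ) (ε : ℝ) : ℕ∞ :=
  sInf {k : ℕ∞ | ∃ (m : ℕ) (x : Fin m → X), k = (m : ℕ∞) ∧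
    1 - ε < μ.real (⋃ i, {y : X | v (x i) y < ε / 2})}

/-- `μ` has bounded complexity with respect to the sequence `w̄_{F_n}`. -/
def HasBoundedComplexity {G X : Type*} [Group G] [MulAction G X] [MeasurableSpace X]
    (μ : Measure X) (F : ℕ → Finset G) (w : X → X → ℝ) : Prop :=
  ∀ ε : ℝ, 0 < ε → ∃ M : ℕ, ∀ n, complexity μ (averageSemimetric w (F n)) ε ≤ (M : ℕ∞)

end

/-! Discrete spectrum means that Koopman orbits in `L²` are precompact, and bounded complexity is a
uniform finite-dimensional approximation of those orbits.

Bounded complexity gives discrete spectrum: suppose `f ≠ 0` is orthogonal to every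
finite-dimensional invariant subspace. The means `T_n` over `F_n` of the rank-one operators `⟨U_g f,
·⟩ U_g f` converge in norm to a compact self-adjoint operator commuting with the action. An
eigenspace for a nonzero eigenvalue would be finite-dimensional and invariant, so the limit is `0`
(`IsFolnerSequence.tendsto_rankOne_mean`). But few averaged balls covering most of `X` place the
`U_g f`, `g ∈ F_n`, near a space of dimension at most `M` in quadratic mean
(`exists_stepFunctions`), which forces `‖f‖² / 2 ≤ M ‖T_n‖` (`sum_norm_sq_le_of_mem`).

Conversely, finitely many continuous functions control a continuous semimetric up to `δ`. If their
orbits are totally bounded, each `g` can be replaced in mean by an element of a fixed finite set; a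
finite cover adapted to that set bounds the complexity for all `n` at once. -/

noncomputable section

open scoped TensorProduct InnerProductSpace

/-! ### Means over finite sets and the mean ergodic theorem -/

section FinsetMean

variable {G E : Type*} (𝕜 : Type*) [RCLike 𝕜]

/-- The mean `(1 / |F|) ∑_{g ∈ F} w g`. -/
def finsetMean [AddCommGroup E] [Module 𝕜 E] (F : Finset G) (w : G → E) : E :=
  ((F.card : 𝕜))⁻¹ • ∑ g ∈ F, w g

/-- The uniform weight on a finite set. -/
def uniformWeight (F : Finset G) : G →₀ 𝕜 :=
  ((F.card : 𝕜))⁻¹ • ∑ g ∈ F, Finsupp.single g 1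

variable {𝕜}

lemma linearCombination_uniformWeight [AddCommGroup E] [Module 𝕜 E] (F : Finset G) (w : G → E) :
    Finsupp.linearCombination 𝕜 w (uniformWeight 𝕜 F) = finsetMean 𝕜 F w := by
  simp [uniformWeight, finsetMean, map_sum]

lemma linearCombination_one_uniformWeight {F : Finset G} (hF : F.Nonempty) :
    Finsupp.linearCombination 𝕜 (fun _ : G => (1 : 𝕜)) (uniformWeight 𝕜 F) = 1 := by
  have : (F.card : 𝕜) ≠ 0 := by exact_mod_cast hF.card_pos.ne'
  simp [uniformWeight, map_sum, this]

variable [NormedAddCommGroup E] [InnerProductSpace 𝕜 E]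

lemma norm_finsetMean_le {F : Finset G} (hF : F.Nonempty) {w : G → E} {B : ℝ}
    (hw : ∀ g, ‖w g‖ ≤ B) : ‖finsetMean 𝕜 F w‖ ≤ B := by
  have hc : (0 : ℝ) < F.card := by exact_mod_cast hF.card_pos
  rw [finsetMean, norm_smul, norm_inv, RCLike.norm_natCast, inv_mul_le_iff₀ hc]
  calc ‖∑ g ∈ F, w g‖ ≤ ∑ _g ∈ F, B := norm_sum_le_of_le _ fun g _ => hw g
    _ = F.card * B := by simp

/-- The first sum runs over `hF`, so terms in `hF ∩ F` cancel and only the symmetric difference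
contributes. -/
lemma norm_sum_mul_left_sub_sum_le [Group G] (F : Finset G) (h : G) {w : G → E} {B : ℝ}
    (hw : ∀ g, ‖w g‖ ≤ B) :
    ‖∑ g ∈ F, w (h * g) - ∑ g ∈ F, w g‖
      ≤ ((h • (F : Set G)) ∆ (F : Set G)).ncard * B := by
  classical
  have h1 : ∑ g ∈ F, w (h * g) = ∑ g ∈ h • F, w g := by
    rw [← Finset.image_smul, Finset.sum_image (by intro a _ b _ hab; simpa using hab)]
    simp
  have h2 : (h • (F : Set G)) ∆ (F : Set G) = (((h • F) \ F ∪ F \ (h • F) : Finset G) : Set G) := by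
    simp [Set.symmDiff_def]
  rw [h1, h2, Set.ncard_coe_finset, Finset.card_union_of_disjoint disjoint_sdiff_sdiff,
    ← Finset.sum_sdiff_sub_sum_sdiff]
  push_cast
  rw [add_mul]
  refine (norm_sub_le _ _).trans (add_le_add ?_ ?_)
  · exact (norm_sum_le_of_le _ fun g _ => hw g).trans (by simp)
  · exact (norm_sum_le_of_le _ fun g _ => hw g).trans (by simp)

lemma IsFolnerSequence.tendsto_finsetMean_mul_left_sub [Group G] {F : ℕ → Finset G}
    (hF : IsFolnerSequence F) (h : G) {w : G → E} {B : ℝ} (hw : ∀ g, ‖w g‖ ≤ B) :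
    Tendsto (fun n => finsetMean 𝕜 (F n) (fun g => w (h * g)) - finsetMean 𝕜 (F n) w)
      atTop (𝓝 0) := by
  have h0 := (hF.tendsto h).mul_const B
  rw [zero_mul] at h0
  refine squeeze_zero_norm (fun n => ?_) h0
  rw [finsetMean, finsetMean, ← smul_sub, norm_smul, norm_inv, RCLike.norm_natCast,
    div_mul_eq_mul_div, div_eq_inv_mul]
  exact mul_le_mul_of_nonneg_left (norm_sum_mul_left_sub_sum_le _ _ hw) (by positivity)

/-- The vectors `∑ α_g w_g` with `∑ α_g = 1`, as weights. -/
def weightHyperplane (G : Type*) (𝕜 : Type*) [RCLike 𝕜] : Set (G →₀ 𝕜) :=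
  {α | Finsupp.linearCombination 𝕜 (fun _ : G => (1 : 𝕜)) α = 1}

lemma norm_linearCombination_mul_right [Group G] {w : G → E}
    (hw : ∀ g h k, ⟪w (g * k), w (h * k)⟫_𝕜 = ⟪w g, w h⟫_𝕜) (α : G →₀ 𝕜) (k : G) :
    ‖Finsupp.linearCombination 𝕜 (fun g => w (g * k)) α‖ = ‖Finsupp.linearCombination 𝕜 w α‖ := by
  have : ⟪Finsupp.linearCombination 𝕜 (fun g => w (g * k)) α,
      Finsupp.linearCombination 𝕜 (fun g => w (g * k)) α⟫_𝕜 =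
      ⟪Finsupp.linearCombination 𝕜 w α, Finsupp.linearCombination 𝕜 w α⟫_𝕜 := by
    simp only [Finsupp.linearCombination_apply, Finsupp.sum, sum_inner, inner_sum,
      inner_smul_left, inner_smul_right, hw]
  rw [@norm_eq_sqrt_re_inner 𝕜, this, ← @norm_eq_sqrt_re_inner 𝕜]

variable (w : G → E)

/-- Parallelogram law: the midpoint of `α` and `β` stays in the hyperplane, so the norm squared of
the sum is at least `4c`, while the right-hand side is at most `4(c + ε)`. -/
lemma norm_linearCombination_sub_sq_le {α β : G →₀ 𝕜} {c ε : ℝ}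
    (hα : α ∈ weightHyperplane G 𝕜) (hβ : β ∈ weightHyperplane G 𝕜)
    (hc : ∀ γ ∈ weightHyperplane G 𝕜, c ≤ ‖Finsupp.linearCombination 𝕜 w γ‖ ^ 2)
    (h1 : ‖Finsupp.linearCombination 𝕜 w α‖ ^ 2 ≤ c + ε)
    (h2 : ‖Finsupp.linearCombination 𝕜 w β‖ ^ 2 ≤ c + ε) :
    ‖Finsupp.linearCombination 𝕜 w α - Finsupp.linearCombination 𝕜 w β‖ ^ 2 ≤ 4 * ε := by
  have hm : (2⁻¹ : 𝕜) • (α + β) ∈ weightHyperplane G 𝕜 := by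
    simp only [weightHyperplane, Set.mem_ofPred_eq] at hα hβ ⊢
    rw [map_smul, map_add, hα, hβ]
    simp only [smul_eq_mul]
    norm_num
  have h3 := hc _ hm
  rw [map_smul, map_add, norm_smul, norm_inv, RCLike.norm_two, mul_pow] at h3
  have h4 := parallelogram_law_with_norm 𝕜 (Finsupp.linearCombination 𝕜 w α)
    (Finsupp.linearCombination 𝕜 w β)
  nlinarith

variable {w}

lemma uniformWeight_mem {F : Finset G} (hF : F.Nonempty) :
    uniformWeight 𝕜 F ∈ weightHyperplane G 𝕜 :=
  linearCombination_one_uniformWeight hF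

lemma mapDomain_uniformWeight_mem [Group G] {F : Finset G} (hF : F.Nonempty) (k : G) :
    (uniformWeight 𝕜 F).mapDomain (· * k) ∈ weightHyperplane G 𝕜 := by
  rw [weightHyperplane, Set.mem_ofPred_eq, Finsupp.linearCombination_mapDomain]
  exact linearCombination_one_uniformWeight hF

/-- **Mean ergodic theorem**, asymptotic minimality of the means. -/
lemma IsFolnerSequence.exists_minimal [Group G] {F : ℕ → Finset G} (hF : IsFolnerSequence F)
    (hw : ∀ g h k, ⟪w (g * k), w (h * k)⟫_𝕜 = ⟪w g, w h⟫_𝕜) :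
    ∃ c : ℝ, (∀ γ ∈ weightHyperplane G 𝕜, c ≤ ‖Finsupp.linearCombination 𝕜 w γ‖ ^ 2) ∧
      ∀ ε > 0, ∀ᶠ n in atTop, ‖finsetMean 𝕜 (F n) w‖ ^ 2 ≤ c + ε := by
  set S : Set ℝ := (fun γ => ‖Finsupp.linearCombination 𝕜 w γ‖ ^ 2) '' weightHyperplane G 𝕜
  have hSb : BddBelow S := ⟨0, by rintro _ ⟨γ, -, rfl⟩; positivity⟩
  have hSn : S.Nonempty := ⟨_, _, uniformWeight_mem (hF.nonempty 0), rfl⟩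
  refine ⟨sInf S, fun γ hγ => csInf_le hSb ⟨γ, hγ, rfl⟩, fun ε hε => ?_⟩
  -- Averaging the right translates of a nearly minimal vector does not increase its norm, and by
  -- the Følner property the average is asymptotically the plain mean of `w`.
  obtain ⟨_, ⟨α, hα, rfl⟩, hlt⟩ := exists_lt_of_csInf_lt hSn (lt_add_of_pos_right (sInf S) hε)
  have hB : ∀ g, ‖w g‖ ≤ ‖w 1‖ := fun g => by
    have := hw 1 1 g
    rw [one_mul] at this
    rw [@norm_eq_sqrt_re_inner 𝕜, this, ← @norm_eq_sqrt_re_inner 𝕜]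
  -- the mean of the translates of `∑ α_h w_h`
  have key : Tendsto (fun n => finsetMean 𝕜 (F n)
      (fun g => Finsupp.linearCombination 𝕜 (fun h => w (h * g)) α) - finsetMean 𝕜 (F n) w)
      atTop (𝓝 0) := by
    have h1 : ∀ n, finsetMean 𝕜 (F n)
        (fun g => Finsupp.linearCombination 𝕜 (fun h => w (h * g)) α) - finsetMean 𝕜 (F n) w =
        ∑ h ∈ α.support, α h •
          (finsetMean 𝕜 (F n) (fun g => w (h * g)) - finsetMean 𝕜 (F n) w) := by
      intro n
      have hα1 : ∑ h ∈ α.support, α h = 1 := by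
        simpa [weightHyperplane, Finsupp.linearCombination_apply, Finsupp.sum] using hα
      simp_rw [smul_sub]
      rw [Finset.sum_sub_distrib, ← Finset.sum_smul, hα1, one_smul]
      congr 1
      simp only [finsetMean, Finsupp.linearCombination_apply, Finsupp.sum]
      rw [Finset.sum_comm, Finset.smul_sum]
      refine Finset.sum_congr rfl fun h _ => ?_
      rw [← Finset.smul_sum, smul_comm]
    simp_rw [h1]
    rw [show (0 : E) = ∑ h ∈ α.support, α h • (0 : E) by simp]
    exact tendsto_finsetSum _ fun h _ =>
      (hF.tendsto_finsetMean_mul_left_sub (𝕜 := 𝕜) h hB).const_smul (α h)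
  have hle : ∀ n, ‖finsetMean 𝕜 (F n) w‖ ≤ ‖Finsupp.linearCombination 𝕜 w α‖ +
      ‖finsetMean 𝕜 (F n) (fun g => Finsupp.linearCombination 𝕜 (fun h => w (h * g)) α)
        - finsetMean 𝕜 (F n) w‖ := by
    intro n
    have := norm_finsetMean_le (𝕜 := 𝕜) (hF.nonempty n) (w := fun g =>
      Finsupp.linearCombination 𝕜 (fun h => w (h * g)) α)
      (fun g => (norm_linearCombination_mul_right hw α g).le)
    have h2 := norm_sub_norm_le (finsetMean 𝕜 (F n) w) (finsetMean 𝕜 (F n)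
      (fun g => Finsupp.linearCombination 𝕜 (fun h => w (h * g)) α))
    rw [norm_sub_rev] at h2
    linarith
  have hlim := ((key.norm.const_add ‖Finsupp.linearCombination 𝕜 w α‖).pow 2)
  rw [norm_zero, add_zero] at hlim
  filter_upwards [hlim.eventually_lt_const hlt] with n hn
  exact (pow_le_pow_left₀ (norm_nonneg _) (hle n) 2).trans hn.le

/-- Right translation preserves norms, so both vectors are nearly minimal, hence close. The case `k
= 1` is the Cauchy property and `m = n` is asymptotic invariance. No limit in `E` is taken, so `E`
may be an incomplete algebraic tensor product. -/
lemma IsFolnerSequence.eventually_norm_sub_lt [Group G] {F : ℕ → Finset G}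
    (hF : IsFolnerSequence F) (hw : ∀ g h k, ⟪w (g * k), w (h * k)⟫_𝕜 = ⟪w g, w h⟫_𝕜)
    (k : G) {ε : ℝ} (hε : 0 < ε) :
    ∃ N, ∀ m ≥ N, ∀ n ≥ N, ‖Finsupp.linearCombination 𝕜 w
      ((uniformWeight 𝕜 (F m)).mapDomain (· * k) - uniformWeight 𝕜 (F n))‖ < ε := by
  obtain ⟨c, hc, hmin⟩ := hF.exists_minimal hw
  obtain ⟨N, hN⟩ := eventually_atTop.1 (hmin (ε ^ 2 / 8) (by positivity))
  refine ⟨N, fun m hm n hn => ?_⟩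
  have h1 : ‖Finsupp.linearCombination 𝕜 w ((uniformWeight 𝕜 (F m)).mapDomain (· * k))‖ ^ 2
      ≤ c + ε ^ 2 / 8 := by
    have := norm_linearCombination_mul_right hw (uniformWeight 𝕜 (F m)) k
    rw [Finsupp.linearCombination_mapDomain]
    rw [show w ∘ (· * k) = fun g => w (g * k) from rfl, this, linearCombination_uniformWeight]
    exact hN m hm
  have h2 : ‖Finsupp.linearCombination 𝕜 w (uniformWeight 𝕜 (F n))‖ ^ 2 ≤ c + ε ^ 2 / 8 := by
    rw [linearCombination_uniformWeight]
    exact hN n hn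
  have := norm_linearCombination_sub_sq_le w (mapDomain_uniformWeight_mem (hF.nonempty m) k)
    (uniformWeight_mem (hF.nonempty n)) hc h1 h2
  rw [map_sub]
  exact lt_of_pow_lt_pow_left₀ 2 hε.le (by nlinarith [sq_pos_of_pos hε])

end FinsetMean

/-! ### Compactness of orbits orthogonal to the finite-dimensional invariant subspaces -/

section RankOne

variable {G H : Type*} [NormedAddCommGroup H] [InnerProductSpace ℂ H]

/-- The operator norm of `∑ α_g u_g ⊗ u_g^*` is at most its Hilbert-Schmidt norm. -/
lemma norm_linearCombination_rankOne_le {C : H → H} (hC : ∀ x y, ⟪C x, C y⟫_ℂ = ⟪y, x⟫_ℂ)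
    (u : G → H) (α : G →₀ ℂ) :
    ‖Finsupp.linearCombination ℂ (fun g => InnerProductSpace.rankOne ℂ (u g) (u g)) α‖ ≤
      ‖Finsupp.linearCombination ℂ (fun g => u g ⊗ₜ[ℂ] C (u g)) α‖ := by
  have hnC : ∀ x, ‖C x‖ = ‖x‖ := fun x => by
    rw [@norm_eq_sqrt_re_inner ℂ, hC, ← @norm_eq_sqrt_re_inner ℂ]
  refine ContinuousLinearMap.opNorm_le_bound _ (norm_nonneg _) fun h => ?_
  set T := Finsupp.linearCombination ℂ (fun g => InnerProductSpace.rankOne ℂ (u g) (u g)) α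
  set L := Finsupp.linearCombination ℂ (fun g => u g ⊗ₜ[ℂ] C (u g)) α
  -- The antiunitary `C` turns `H ⊗ H` into a model of the finite-rank operators with the
  -- Hilbert-Schmidt inner product. Cauchy-Schwarz with `k = T h` then gives the bound.
  have key : ∀ k, ⟪k, T h⟫_ℂ = ⟪k ⊗ₜ[ℂ] C h, L⟫_ℂ := by
    intro k
    simp only [T, L, Finsupp.linearCombination_apply, Finsupp.sum, sum_apply,
      inner_sum, inner_smul_right, smul_apply, InnerProductSpace.rankOne_apply,
      TensorProduct.inner_tmul, hC]
    refine Finset.sum_congr rfl fun g _ => ?_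
    ring
  have h1 : ‖T h‖ * ‖T h‖ ≤ ‖T h‖ * (‖L‖ * ‖h‖) := by
    rw [← inner_self_eq_norm_mul_norm (𝕜 := ℂ) (T h), key]
    refine (RCLike.re_le_norm _).trans ((norm_inner_le_norm (𝕜 := ℂ) (T h ⊗ₜ[ℂ] C h) L).trans ?_)
    rw [TensorProduct.norm_tmul, hnC]
    exact le_of_eq (by ring)
  rcases (norm_nonneg (T h)).eq_or_lt with h0 | h0
  · rw [← h0]; positivity
  · exact le_of_mul_le_mul_left h1 h0

lemma isCompactOperator_rankOne (x y : H) :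
    IsCompactOperator (InnerProductSpace.rankOne ℂ x y) := by
  rw [InnerProductSpace.rankOne_def']
  exact (isCompactOperator_of_locallyCompactSpace_rng
    (ContinuousLinearMap.toSpanSingleton ℂ x)).comp_clm _

lemma isCompactOperator_finsetMean_rankOne (F : Finset G) (u : G → H) :
    IsCompactOperator
      (Finsupp.linearCombination ℂ (fun g => InnerProductSpace.rankOne ℂ (u g) (u g))
        (uniformWeight ℂ F)) := by
  have : ∀ α : G →₀ ℂ, Finsupp.linearCombination ℂ
      (fun g => InnerProductSpace.rankOne ℂ (u g) (u g)) α ∈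
      compactOperator (RingHom.id ℂ) H H := fun α => by
    rw [Finsupp.linearCombination_apply]
    exact Submodule.sum_mem _ fun g _ => Submodule.smul_mem _ _ (isCompactOperator_rankOne _ _)
  exact this _

variable [Group G] [CompleteSpace H]

/-- If `f` is orthogonal to every finite-dimensional invariant subspace, then the operators
`(1 / |F_n|) ∑_{g ∈ F_n} ⟨U_g f, ·⟩ U_g f` tend to `0` in norm. -/
theorem IsFolnerSequence.tendsto_rankOne_mean {F : ℕ → Finset G} (hF : IsFolnerSequence F)
    {C : H → H} (hC : ∀ x y, ⟪C x, C y⟫_ℂ = ⟪y, x⟫_ℂ) (U : G → H →ₗᵢ[ℂ] H)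
    (hU1 : ∀ x, U 1 x = x) (hU : ∀ g h x, U g (U h x) = U (h * g) x) {f : H}
    (hf : ∀ V : Submodule ℂ H, FiniteDimensional ℂ V → (∀ g, ∀ v ∈ V, U g v ∈ V) →
      ∀ v ∈ V, ⟪f, v⟫_ℂ = 0) :
    Tendsto (fun n => Finsupp.linearCombination ℂ
      (fun g => InnerProductSpace.rankOne ℂ (U g f) (U g f)) (uniformWeight ℂ (F n)))
      atTop (𝓝 0) := by
  set R : G → H →L[ℂ] H := fun g => InnerProductSpace.rankOne ℂ (U g f) (U g f) with hR
  set w : G → H ⊗[ℂ] H := fun g => U g f ⊗ₜ[ℂ] C (U g f) with hw'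
  set T : ℕ → H →L[ℂ] H := fun n => Finsupp.linearCombination ℂ R (uniformWeight ℂ (F n)) with hT'
  -- Since `U (g * k) = U k ∘ U g`, right translation of the index acts isometrically.
  have hw : ∀ g h k, ⟪w (g * k), w (h * k)⟫_ℂ = ⟪w g, w h⟫_ℂ := fun g h k => by
    simp only [hw', TensorProduct.inner_tmul, hC, ← hU, LinearIsometry.inner_map_map]
  have hclose : ∀ (k : G) (ε : ℝ), 0 < ε → ∃ N, ∀ m ≥ N, ∀ n ≥ N, ‖Finsupp.linearCombination ℂ R
      ((uniformWeight ℂ (F m)).mapDomain (· * k)) - T n‖ < ε := by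
    intro k ε hε
    obtain ⟨N, hN⟩ := hF.eventually_norm_sub_lt (𝕜 := ℂ) (w := w) hw k hε
    refine ⟨N, fun m hm n hn => ?_⟩
    rw [hT', ← map_sub]
    exact (norm_linearCombination_rankOne_le hC _ _).trans_lt (hN m hm n hn)
  have hcauchy : CauchySeq T := by
    refine Metric.cauchySeq_iff.2 fun ε hε => ?_
    obtain ⟨N, hN⟩ := hclose 1 ε hε
    refine ⟨N, fun m hm n hn => ?_⟩
    have := hN m hm n hn
    simp only [mul_one] at this
    rw [dist_eq_norm]
    rwa [show (fun x : G => x) = id from rfl, Finsupp.mapDomain_id] at this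
  obtain ⟨S, hS⟩ := cauchySeq_tendsto_of_complete hcauchy
  have hSapp : ∀ x, Tendsto (fun n => T n x) atTop (𝓝 (S x)) := fun x =>
    ((ContinuousLinearMap.apply ℂ H x).continuous.tendsto S).comp hS
  have hcomp : IsCompactOperator S :=
    isCompactOperator_of_tendsto hS
      (Eventually.of_forall fun n => isCompactOperator_finsetMean_rankOne (F n) _)
  have hTapp : ∀ n x, T n x = finsetMean ℂ (F n) (fun g => ⟪U g f, x⟫_ℂ • U g f) := fun n x => by
    simp only [hT']
    rw [linearCombination_uniformWeight]
    simp [finsetMean, hR, sum_apply]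
  have hsymmT : ∀ n x y, ⟪T n x, y⟫_ℂ = ⟪x, T n y⟫_ℂ := fun n x y => by
    rw [hTapp, hTapp]
    simp only [finsetMean, inner_smul_left, inner_smul_right, sum_inner, inner_sum, map_inv₀,
      Complex.conj_natCast, inner_conj_symm]
    congr 1
    exact Finset.sum_congr rfl fun g _ => mul_comm _ _
  have hsymm : (S : H →ₗ[ℂ] H).IsSymmetric := fun x y => by
    refine tendsto_nhds_unique ((hSapp x).inner tendsto_const_nhds) ?_
    simp_rw [hsymmT]
    exact tendsto_const_nhds.inner (hSapp y)
  -- The mean over `F_n k`, applied to `U k x`, equals `U k (T n x)`; the means over `F_n k` and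
  -- over `F_n` have the same limit `S`.
  have hcomm : ∀ k x, S (U k x) = U k (S x) := by
    intro k x
    have h1 : Tendsto (fun n => Finsupp.linearCombination ℂ R
        ((uniformWeight ℂ (F n)).mapDomain (· * k))) atTop (𝓝 S) := by
      rw [← sub_zero S] at hS ⊢
      have h0 : Tendsto (fun n => Finsupp.linearCombination ℂ R
        ((uniformWeight ℂ (F n)).mapDomain (· * k)) - T n) atTop (𝓝 0) := by
        refine Metric.tendsto_atTop.2 fun ε hε => ?_
        obtain ⟨N, hN⟩ := hclose k ε hε
        exact ⟨N, fun n hn => by simpa [dist_eq_norm] using hN n hn n hn⟩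
      simpa using h0.add hS
    have h2 := ((ContinuousLinearMap.apply ℂ H (U k x)).continuous.tendsto S).comp h1
    refine tendsto_nhds_unique h2 ?_
    have h3 := ((U k).continuous.tendsto (S x)).comp (hSapp x)
    refine h3.congr fun n => ?_
    simp only [Function.comp_apply, ContinuousLinearMap.apply_apply]
    rw [hTapp, Finsupp.linearCombination_mapDomain, linearCombination_uniformWeight]
    simp only [finsetMean, map_smul, map_sum, hR, Function.comp_apply,
      InnerProductSpace.rankOne_apply, ← hU k, sum_apply, LinearIsometry.inner_map_map,
      smul_apply]
  have hzero : S = 0 := by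
    rw [← ContinuousLinearMap.eq_zero_of_forall_hasEigenvalue_eq_zero hcomp hsymm]
    intro c hc
    by_contra hc0
    obtain ⟨v, hv, hv0⟩ := hc.exists_hasEigenvector
    set V := Module.End.eigenspace (S : H →ₗ[ℂ] H) c with hV
    have hVfd : FiniteDimensional ℂ V :=
      ContinuousLinearMap.finite_dimensional_eigenspace hcomp c hc0
    have hVinv : ∀ g, ∀ x ∈ V, U g x ∈ V := fun g x hx => by
      rw [hV, Module.End.mem_eigenspace_iff] at hx ⊢
      have hx' : S x = c • x := hx
      change S (U g x) = c • U g x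
      rw [hcomm, hx', map_smul]
    -- The whole orbit of `f` is orthogonal to the invariant eigenspace, so every `T n` kills `v`,
    -- and so does `S`.
    have horth : ∀ g, ⟪U g f, v⟫_ℂ = 0 := fun g => by
      have h1 : v = U g (U g⁻¹ v) := by rw [hU, inv_mul_cancel, hU1]
      rw [h1, LinearIsometry.inner_map_map]
      exact hf V hVfd hVinv _ (hVinv _ _ hv)
    have hSv : S v = 0 := by
      refine tendsto_nhds_unique (hSapp v) ?_
      simp [hTapp, horth, finsetMean]
    have : S v = c • v := Module.End.mem_eigenspace_iff.1 hv
    rw [hSv] at this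
    exact (smul_ne_zero hc0 hv0) this.symm
  rw [← hzero]
  exact hS

end RankOne

/-! ### Bounded complexity implies discrete spectrum -/

section Projection

variable {G H : Type*} [NormedAddCommGroup H] [InnerProductSpace ℂ H]

/-- Split `u g` by Pythagoras. The part orthogonal to `V` is at most `u g - v g` in norm; the mean
square of the part in `V` is the trace of `T` compressed to `V`, at most `dim V · ‖T‖`. -/
lemma sum_norm_sq_le_of_mem (F : Finset G) (hF : F.Nonempty) (u v : G → H) (V : Submodule ℂ H)
    [FiniteDimensional ℂ V] (hv : ∀ g, v g ∈ V) :
    ∑ g ∈ F, ‖u g‖ ^ 2 ≤ ∑ g ∈ F, ‖u g - v g‖ ^ 2 + F.card * (Module.finrank ℂ V *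
      ‖Finsupp.linearCombination ℂ (fun g => InnerProductSpace.rankOne ℂ (u g) (u g))
        (uniformWeight ℂ F)‖) := by
  set T := Finsupp.linearCombination ℂ (fun g => InnerProductSpace.rankOne ℂ (u g) (u g))
        (uniformWeight ℂ F) with hT
  have hc : (F.card : ℝ) ≠ 0 := by exact_mod_cast hF.card_pos.ne'
  have h1 : ∀ g, ‖u g‖ ^ 2 ≤ ‖u g - v g‖ ^ 2 + ‖V.orthogonalProjectionOnto (u g)‖ ^ 2 := by
    intro g
    have h2 := V.norm_sq_eq_add_norm_sq_starProjection (u g)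
    have h3 : ‖Vᗮ.starProjection (u g)‖ ≤ ‖u g - v g‖ := by
      rw [Submodule.starProjection_orthogonal_val, Submodule.starProjection_minimal]
      exact ciInf_le ⟨0, by rintro _ ⟨_, rfl⟩; positivity⟩ (⟨v g, hv g⟩ : V)
    have h4 := pow_le_pow_left₀ (norm_nonneg _) h3 2
    have h5 : ‖V.starProjection (u g)‖ = ‖V.orthogonalProjectionOnto (u g)‖ := rfl
    rw [h5] at h2
    linarith
  set b := stdOrthonormalBasis ℂ V
  have h2 : ∀ i, ∑ g ∈ F, ‖⟪(b i : H), u g⟫_ℂ‖ ^ 2 ≤ F.card * ‖T‖ := by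
    intro i
    have h3 : ⟪(b i : H), T (b i)⟫_ℂ =
        (((F.card : ℝ)⁻¹ * ∑ g ∈ F, ‖⟪(b i : H), u g⟫_ℂ‖ ^ 2 : ℝ) : ℂ) := by
      rw [hT, linearCombination_uniformWeight]
      simp only [finsetMean, smul_apply, sum_apply, InnerProductSpace.rankOne_apply,
        inner_smul_right, inner_sum]
      push_cast
      congr 1
      refine Finset.sum_congr rfl fun g _ => ?_
      rw [← inner_conj_symm, RCLike.conj_mul]
      rfl
    have h4 : ‖⟪(b i : H), T (b i)⟫_ℂ‖ ≤ ‖T‖ := by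
      have hb : ‖(b i : H)‖ = 1 := b.norm_eq_one i
      refine (norm_inner_le_norm _ _).trans ?_
      rw [hb, one_mul]
      simpa [hb] using T.le_opNorm (b i)
    rw [h3, Complex.norm_real, Real.norm_of_nonneg (by positivity)] at h4
    rwa [inv_mul_le_iff₀ (lt_of_le_of_ne (by positivity) hc.symm)] at h4
  calc ∑ g ∈ F, ‖u g‖ ^ 2
      ≤ ∑ g ∈ F, (‖u g - v g‖ ^ 2 + ‖V.orthogonalProjectionOnto (u g)‖ ^ 2) :=
        Finset.sum_le_sum fun g _ => h1 g
    _ = ∑ g ∈ F, ‖u g - v g‖ ^ 2 + ∑ i, ∑ g ∈ F, ‖⟪(b i : H), u g⟫_ℂ‖ ^ 2 := by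
        rw [Finset.sum_add_distrib, Finset.sum_comm]
        congr 1
        refine Finset.sum_congr rfl fun g _ => ?_
        rw [← b.sum_sq_norm_inner_right]
        refine Finset.sum_congr rfl fun i _ => ?_
        rw [← Submodule.inner_orthogonalProjectionOnto_eq_of_mem_left]
    _ ≤ ∑ g ∈ F, ‖u g - v g‖ ^ 2 + ∑ _i : Fin (Module.finrank ℂ V), F.card * ‖T‖ := by
        gcongr with i
        exact h2 i
    _ = _ := by
        simp only [Finset.sum_const, Finset.card_univ, Fintype.card_fin, nsmul_eq_mul]
        ring

end Projection

/-! ### Continuous semimetrics and complexity -/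

section Semimetric

lemma IsContinuousSemimetric.continuous {X : Type*} [t : TopologicalSpace X] {ρ : X → X → ℝ}
    (h : IsContinuousSemimetric ρ) : Continuous fun p : X × X => ρ p.1 p.2 := by
  obtain ⟨hs, hc⟩ := h
  let τ : TopologicalSpace X := hs.toPseudoMetricSpace.toUniformSpace.toTopologicalSpace
  have hd : @Continuous (X × X) ℝ (@instTopologicalSpaceProd X X τ τ) _ fun p => ρ p.1 p.2 :=
    @continuous_dist X hs.toPseudoMetricSpace
  exact @Continuous.comp (X × X) (X × X) ℝ (@instTopologicalSpaceProd X X t t)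
    (@instTopologicalSpaceProd X X τ τ) _ (Prod.map id id)
    _ hd (@Continuous.prodMap X X X X τ τ t t id id hc hc)

lemma isContinuousMetric_dist {X : Type*} [MetricSpace X] :
    IsContinuousMetric fun x y : X => dist x y := by
  refine ⟨⟨⟨fun _ _ => dist_nonneg, dist_self, dist_comm, dist_triangle⟩, ?_⟩,
    fun x y h => dist_eq_zero.1 h⟩
  refine (@Metric.continuous_iff X X _ (IsSemimetric.toPseudoMetricSpace _) _).2 ?_
  exact fun b ε hε => ⟨ε, hε, fun a ha => ha⟩

/-- On a compact space a continuous function is controlled by any continuous metric. -/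
lemma IsContinuousMetric.exists_norm_sub_sq_le {X : Type*} [TopologicalSpace X] [CompactSpace X]
    {ρ : X → X → ℝ} (h : IsContinuousMetric ρ) {E : Type*} [SeminormedAddCommGroup E] (φ : C(X, E))
    {δ : ℝ} (hδ : 0 < δ) :
    ∃ C : ℝ, 0 ≤ C ∧ ∀ x y, ‖φ x - φ y‖ ^ 2 ≤ δ + C * ρ x y := by
  have hρ := h.1.continuous
  obtain ⟨⟨hs, -⟩, hsep⟩ := h
  have hψ : Continuous fun p : X × X => ‖φ p.1 - φ p.2‖ ^ 2 := by fun_prop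
  set S : Set (X × X) := {p | δ ≤ ‖φ p.1 - φ p.2‖ ^ 2} with hS
  have hScomp : IsCompact S := (isClosed_le continuous_const hψ).isCompact
  rcases S.eq_empty_or_nonempty with hS0 | hS0
  · refine ⟨0, le_rfl, fun x y => ?_⟩
    have : (x, y) ∉ S := by simp [hS0]
    simp only [hS, Set.mem_ofPred_eq, not_le] at this
    linarith
  obtain ⟨p, hpS, hp⟩ := hScomp.exists_isMinOn hS0 hρ.continuousOn
  obtain ⟨q, -, hq⟩ := hScomp.exists_isMaxOn hS0 hψ.continuousOn
  have hpos : 0 < ρ p.1 p.2 := by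
    refine lt_of_le_of_ne (hs.nonneg _ _) fun h0 => ?_
    have := hsep _ _ h0.symm
    simp only [hS, Set.mem_ofPred_eq, this, sub_self, norm_zero] at hpS
    norm_num at hpS
    linarith
  refine ⟨‖φ q.1 - φ q.2‖ ^ 2 / ρ p.1 p.2, by positivity, fun x y => ?_⟩
  by_cases hxy : (x, y) ∈ S
  · have h1 : ρ p.1 p.2 ≤ ρ x y := hp hxy
    have h2 : ‖φ x - φ y‖ ^ 2 ≤ ‖φ q.1 - φ q.2‖ ^ 2 := hq hxy
    have h3 : ‖φ q.1 - φ q.2‖ ^ 2 ≤ ‖φ q.1 - φ q.2‖ ^ 2 / ρ p.1 p.2 * ρ x y := by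
      rw [div_mul_eq_mul_div, le_div_iff₀ hpos]
      gcongr
    linarith
  · simp only [hS, Set.mem_ofPred_eq, not_le] at hxy
    have := hs.nonneg x y
    have : 0 ≤ ‖φ q.1 - φ q.2‖ ^ 2 / ρ p.1 p.2 * ρ x y := by positivity
    linarith

lemma complexity_le_iff {X : Type*} [MeasurableSpace X] {μ : Measure X} {v : X → X → ℝ} {ε : ℝ}
    {M : ℕ} : complexity μ v ε ≤ (M : ℕ∞) ↔ ∃ m ≤ M, ∃ x : Fin m → X,
      1 - ε < μ.real (⋃ i, {y : X | v (x i) y < ε / 2}) := by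
  constructor
  · intro h
    have hne : {k : ℕ∞ | ∃ (m : ℕ) (x : Fin m → X), k = (m : ℕ∞) ∧
        1 - ε < μ.real (⋃ i, {y : X | v (x i) y < ε / 2})}.Nonempty := by
      by_contra hcon
      rw [Set.not_nonempty_iff_eq_empty] at hcon
      rw [complexity, hcon, sInf_empty, top_le_iff] at h
      exact ENat.natCast_ne_top M h
    obtain ⟨m, x, hm, hx⟩ := csInf_mem hne
    refine ⟨m, ?_, x, hx⟩
    rw [complexity, hm] at h
    exact_mod_cast h
  · rintro ⟨m, hm, x, hx⟩
    have hmM : (m : ℕ∞) ≤ M := by exact_mod_cast hm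
    refine le_trans (sInf_le ?_) hmM
    exact ⟨m, x, rfl, hx⟩

lemma continuous_averageSemimetric {G X : Type*} [Group G] [TopologicalSpace X] [MulAction G X]
    [ContinuousConstSMul G X] {ρ : X → X → ℝ} (hρ : IsContinuousSemimetric ρ) (F : Finset G)
    (x : X) : Continuous (averageSemimetric ρ F x) := by
  have := hρ.continuous
  refine continuous_const.mul (continuous_finsetSum _ fun g _ => ?_)
  exact this.comp (continuous_const.prodMk (continuous_const_smul g))

end Semimetric

/-! ### Koopman operators on `L²` -/

section Koopman

variable {X : Type*} [MeasurableSpace X] {μ : Measure X}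

lemma Lp_integrable_norm_sq (f : Lp ℂ 2 μ) : Integrable (fun x => ‖f x‖ ^ 2) μ :=
  (memLp_two_iff_integrable_sq_norm (Lp.aestronglyMeasurable f)).1 (Lp.memLp f)

lemma Lp_norm_sq_eq_integral (f : Lp ℂ 2 μ) : ‖f‖ ^ 2 = ∫ x, ‖f x‖ ^ 2 ∂μ := by
  have h := inner_self_eq_norm_sq_to_K (𝕜 := ℂ) f
  rw [L2.inner_def] at h
  simp_rw [inner_self_eq_norm_sq_to_K] at h
  have h2 : ((∫ x, ‖f x‖ ^ 2 ∂μ : ℝ) : ℂ) = ((‖f‖ ^ 2 : ℝ) : ℂ) := by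
    rw [← integral_complex_ofReal]
    push_cast
    exact h
  exact (Complex.ofReal_injective h2).symm

lemma Lp_coeFn_sum {ι : Type*} (s : Finset ι) (f : ι → Lp ℂ 2 μ) :
    ((∑ i ∈ s, f i : Lp ℂ 2 μ) : X → ℂ) =ᵐ[μ] fun x => ∑ i ∈ s, f i x := by
  classical
  induction s using Finset.induction_on with
  | empty =>
    simp only [Finset.sum_empty]
    exact Lp.coeFn_zero ℂ 2 μ
  | insert i s hi ih =>
    rw [Finset.sum_insert hi]
    filter_upwards [Lp.coeFn_add (f i) (∑ j ∈ s, f j), ih] with x h1 h2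
    rw [h1, Pi.add_apply, h2, Finset.sum_insert hi]

/-- Complex conjugation serves as the antiunitary `C` of the rank-one estimates. -/
lemma Lp_inner_star_star (f g : Lp ℂ 2 μ) : ⟪star f, star g⟫_ℂ = ⟪g, f⟫_ℂ := by
  rw [L2.inner_def, L2.inner_def]
  refine integral_congr_ae ?_
  filter_upwards [Lp.coeFn_star f, Lp.coeFn_star g] with x hf hg
  rw [hf, hg]
  simp [mul_comm]

variable {G : Type*} [Group G] [MulAction G X] [MeasurableConstSMul G X]
  (μ) [SMulInvariantMeasure G X μ]

/-- The Koopman operator as a linear isometry. -/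
def koopmanIsometry (g : G) : Lp ℂ 2 μ →ₗᵢ[ℂ] Lp ℂ 2 μ :=
  Lp.compMeasurePreservingₗᵢ ℂ (fun x : X => g • x) (measurePreserving_smul g μ)

lemma coeFn_koopman (g : G) (f : Lp ℂ 2 μ) : koopman μ g f =ᵐ[μ] fun x => f (g • x) :=
  Lp.coeFn_compMeasurePreserving f _

lemma koopman_one (f : Lp ℂ 2 μ) : koopman μ (1 : G) f = f := by
  refine Lp.ext ?_
  filter_upwards [coeFn_koopman μ (1 : G) f] with x hx
  rw [hx, one_smul]

lemma koopman_koopman (g h : G) (f : Lp ℂ 2 μ) :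
    koopman μ g (koopman μ h f) = koopman μ (h * g) f := by
  refine Lp.ext ?_
  filter_upwards [coeFn_koopman μ g (koopman μ h f), coeFn_koopman μ (h * g) f,
    (measurePreserving_smul g μ).quasiMeasurePreserving.ae (coeFn_koopman μ h f)] with x h1 h2 h3
  rw [h1, h2, h3, mul_smul]

end Koopman

section Main

variable {G X : Type*} [Group G] [MetricSpace X] [CompactSpace X] [MeasurableSpace X]
  [BorelSpace X] [MulAction G X] [ContinuousConstSMul G X] {μ : Measure X} [IsProbabilityMeasure μ]

/-- The translates of a continuous function by a finite set are close in mean to the step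
functions of a cover of most of the space by few balls. -/
lemma exists_stepFunctions [SMulInvariantMeasure G X μ] {ρ : X → X → ℝ}
    (hρ : IsContinuousSemimetric ρ) (F : Finset G) (hF : F.Nonempty) (φ : C(X, ℂ)) {δ C ε : ℝ}
    (hδ : 0 ≤ δ) (hC : 0 ≤ C) (hε : 0 < ε)
    (hφ : ∀ x y, ‖φ x - φ y‖ ^ 2 ≤ δ + C * ρ x y) {m : ℕ} (x : Fin m → X)
    (hx : 1 - ε < μ.real (⋃ i, {y : X | averageSemimetric ρ F (x i) y < ε / 2})) :
    ∃ V : Submodule ℂ (Lp ℂ 2 μ), FiniteDimensional ℂ V ∧ Module.finrank ℂ V ≤ m ∧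
      ∃ v : G → Lp ℂ 2 μ, (∀ g, v g ∈ V) ∧
        ∑ g ∈ F, ‖koopman μ g (φ.toLp 2 μ ℂ) - v g‖ ^ 2
          ≤ F.card * (δ + C * (ε / 2) + ‖φ‖ ^ 2 * ε) := by
  set s : Fin m → Set X := fun i => {y : X | averageSemimetric ρ F (x i) y < ε / 2} with hs
  have hso : ∀ i, MeasurableSet (s i) := fun i =>
    (isOpen_lt (continuous_averageSemimetric hρ F (x i)) continuous_const).measurableSet
  -- The balls are made disjoint. The step function for `g` takes the value `φ (g • x i)` on `B i`;
  -- the sets `B i` do not depend on `g`, hence a single `V`.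
  set B : Fin m → Set X := fun i => s i \ ⋃ j, ⋃ _ : j < i, s j with hB
  have hBm : ∀ i, MeasurableSet (B i) := fun i =>
    (hso i).diff (MeasurableSet.iUnion fun j => MeasurableSet.iUnion fun _ => hso j)
  have hBU : ∀ y ∈ ⋃ i, s i, ∃ i, y ∈ s i ∧ ∀ j, y ∈ B j ↔ j = i := by
    intro y hy
    rw [Set.mem_iUnion] at hy
    obtain ⟨i, hi, hmin⟩ := WellFounded.has_min (r := ((· < ·) : Fin m → Fin m → Prop))
      wellFounded_lt {i | y ∈ s i} hy
    refine ⟨i, hi, fun j => ⟨fun hj => ?_, ?_⟩⟩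
    · rcases lt_trichotomy j i with h | h | h
      · exact absurd h (hmin j hj.1)
      · exact h
      · exact absurd (Set.mem_iUnion₂.2 ⟨i, h, hi⟩) hj.2
    · rintro rfl
      exact ⟨hi, fun h => by
        obtain ⟨k, hk, hyk⟩ := Set.mem_iUnion₂.1 h
        exact hmin k hyk hk⟩
  have hBU' : ∀ y ∉ ⋃ i, s i, ∀ j, y ∉ B j := fun y hy j hj => hy (Set.mem_iUnion.2 ⟨j, hj.1⟩)
  let e : Fin m → Lp ℂ 2 μ := fun i => indicatorConstLp 2 (hBm i) (measure_ne_top μ _) (1 : ℂ)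
  refine ⟨Submodule.span ℂ (Set.range e),
    FiniteDimensional.span_of_finite ℂ (Set.finite_range e),
    (finrank_range_le_card e).trans (by simp), fun g => ∑ i, φ (g • x i) • e i,
    fun g => Submodule.sum_mem _ fun i _ => Submodule.smul_mem _ _ (Submodule.subset_span ⟨i, rfl⟩),
    ?_⟩
  set D : G → X → ℂ := fun g y => φ (g • y) - ∑ i, φ (g • x i) * (B i).indicator (fun _ => 1) y
    with hD
  have hae : ∀ g, (koopman μ g (φ.toLp 2 μ ℂ) - ∑ i, φ (g • x i) • e i : Lp ℂ 2 μ) =ᵐ[μ] D g := by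
    intro g
    have h1 : ((∑ i, φ (g • x i) • e i : Lp ℂ 2 μ) : X → ℂ) =ᵐ[μ]
        fun y => ∑ i, φ (g • x i) * (B i).indicator (fun _ => 1) y := by
      refine (Lp_coeFn_sum _ _).trans ?_
      have h2 : ∀ i, ((φ (g • x i) • e i : Lp ℂ 2 μ) : X → ℂ) =ᵐ[μ]
          fun y => φ (g • x i) * (B i).indicator (fun _ => 1) y := fun i => by
        filter_upwards [Lp.coeFn_smul (φ (g • x i)) (e i),
          indicatorConstLp_coeFn (p := 2) (hs := hBm i) (hμs := measure_ne_top μ _) (c := (1 : ℂ))]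
          with y h3 h4
        rw [h3, Pi.smul_apply, h4, smul_eq_mul]
      filter_upwards [ae_all_iff.2 h2] with y hy
      simp [hy]
    filter_upwards [Lp.coeFn_sub (koopman μ g (φ.toLp 2 μ ℂ)) (∑ i, φ (g • x i) • e i), h1,
      coeFn_koopman μ g (φ.toLp 2 μ ℂ), (measurePreserving_smul g μ).quasiMeasurePreserving.ae
        (ContinuousMap.coeFn_toLp (p := 2) (𝕜 := ℂ) μ φ)] with y h2 h3 h4 h5
    rw [h2, Pi.sub_apply, h3, h4, h5]
  have hint : ∀ g, Integrable (fun y => ‖D g y‖ ^ 2) μ := fun g => by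
    refine (Lp_integrable_norm_sq (koopman μ g (φ.toLp 2 μ ℂ) - ∑ i, φ (g • x i) • e i)).congr ?_
    filter_upwards [hae g] with y hy
    rw [hy]
  have hnorm : ∀ g, ‖koopman μ g (φ.toLp 2 μ ℂ) - ∑ i, φ (g • x i) • e i‖ ^ 2 =
      ∫ y, ‖D g y‖ ^ 2 ∂μ := fun g => by
    rw [Lp_norm_sq_eq_integral]
    refine integral_congr_ae ?_
    filter_upwards [hae g] with y hy
    rw [hy]
  have hc : (0 : ℝ) < F.card := by exact_mod_cast hF.card_pos
  have hUm : MeasurableSet (⋃ i, s i) := MeasurableSet.iUnion hso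
  -- On the covered set, summing over `g` turns `ρ` into its average; elsewhere the step functions
  -- vanish and the bound by `‖φ‖` is paid on measure at most `ε`.
  have hpt : ∀ y, ∑ g ∈ F, ‖D g y‖ ^ 2 ≤ F.card * (δ + C * (ε / 2)) +
      (⋃ i, s i)ᶜ.indicator (fun _ => F.card * ‖φ‖ ^ 2) y := by
    intro y
    by_cases hy : y ∈ ⋃ i, s i
    · obtain ⟨i, hi, hij⟩ := hBU y hy
      have hDg : ∀ g, D g y = φ (g • y) - φ (g • x i) := fun g => by
        simp only [hD]
        congr 1
        rw [Finset.sum_eq_single i]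
        · rw [Set.indicator_of_mem ((hij i).2 rfl), mul_one]
        · intro j _ hj
          rw [Set.indicator_of_notMem (fun h => hj ((hij j).1 h)), mul_zero]
        · simp
      rw [Set.indicator_of_notMem (by simpa using hy), add_zero]
      calc ∑ g ∈ F, ‖D g y‖ ^ 2 ≤ ∑ g ∈ F, (δ + C * ρ (g • x i) (g • y)) := by
            refine Finset.sum_le_sum fun g _ => ?_
            rw [hDg, norm_sub_rev]
            exact hφ _ _
        _ = F.card * (δ + C * averageSemimetric ρ F (x i) y) := by
            rw [Finset.sum_add_distrib, ← Finset.mul_sum, averageSemimetric]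
            simp only [Finset.sum_const, nsmul_eq_mul]
            field_simp
        _ ≤ _ := by
            have : averageSemimetric ρ F (x i) y ≤ ε / 2 := le_of_lt hi
            gcongr
    · rw [Set.indicator_of_mem (by simpa using hy)]
      have hDg : ∀ g, D g y = φ (g • y) := fun g => by
        simp only [hD]
        rw [Finset.sum_eq_zero, sub_zero]
        intro j _
        rw [Set.indicator_of_notMem (hBU' y hy j), mul_zero]
      have : ∑ g ∈ F, ‖D g y‖ ^ 2 ≤ ∑ _g ∈ F, ‖φ‖ ^ 2 := by
        refine Finset.sum_le_sum fun g _ => ?_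
        rw [hDg]
        exact pow_le_pow_left₀ (norm_nonneg _) (φ.norm_coe_le_norm _) 2
      rw [Finset.sum_const, nsmul_eq_mul] at this
      have : 0 ≤ F.card * (δ + C * (ε / 2)) := by positivity
      linarith
  have hcompl : μ.real (⋃ i, s i)ᶜ ≤ ε := by
    rw [probReal_compl_eq_one_sub hUm]
    linarith
  simp_rw [hnorm]
  rw [← integral_finsetSum _ fun g _ => hint g]
  calc ∫ y, ∑ g ∈ F, ‖D g y‖ ^ 2 ∂μ
      ≤ ∫ y, (F.card * (δ + C * (ε / 2)) +
        (⋃ i, s i)ᶜ.indicator (fun _ => F.card * ‖φ‖ ^ 2) y) ∂μ := by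
        refine integral_mono (integrable_finsetSum _ fun g _ => hint g) ?_ hpt
        exact (integrable_const _).add ((integrable_const _).indicator hUm.compl)
    _ = F.card * (δ + C * (ε / 2)) + μ.real (⋃ i, s i)ᶜ * (F.card * ‖φ‖ ^ 2) := by
        rw [integral_add (integrable_const _) ((integrable_const _).indicator hUm.compl),
          integral_indicator_const _ hUm.compl]
        simp
    _ ≤ F.card * (δ + C * (ε / 2)) + ε * (F.card * ‖φ‖ ^ 2) := by gcongr
    _ = _ := by ring

/-- A nonzero `f` orthogonal to the discrete spectrum part has rank-one means tending to `0`,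
whereas the complexity bound keeps `M` times their norm above `‖f‖² / 2`. -/
theorem HasBoundedComplexity.hasDiscreteSpectrum [SMulInvariantMeasure G X μ] {F : ℕ → Finset G}
    (hF : IsFolnerSequence F) {ρ : X → X → ℝ} (hρ : IsContinuousMetric ρ)
    (h : HasBoundedComplexity μ F ρ) : HasDiscreteSpectrum G μ := by
  have : (discreteSpectrumSubspace G μ).HasOrthogonalProjection := by
    have : CompleteSpace (discreteSpectrumSubspace G μ) :=
      (Submodule.isClosed_topologicalClosure _).completeSpace_coe
    infer_instance
  rw [HasDiscreteSpectrum, ← Submodule.orthogonal_eq_bot_iff, Submodule.eq_bot_iff]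
  intro f hf
  by_contra hf0
  have hfpos : 0 < ‖f‖ ^ 2 := by positivity
  have hlim := hF.tendsto_rankOne_mean (C := star) Lp_inner_star_star (koopmanIsometry μ)
    (fun x => koopman_one μ x) (fun g h x => koopman_koopman μ g h x) (f := f)
    (fun V hV hVi v hv => by
      have hVmem : V ∈ {V : Submodule ℂ (Lp ℂ 2 μ) |
          FiniteDimensional ℂ V ∧ ∀ g : G, ∀ f ∈ V, koopman μ g f ∈ V} := ⟨hV, hVi⟩
      exact Submodule.inner_left_of_mem_orthogonal
        (Submodule.le_topologicalClosure _ (Submodule.mem_sSup_of_mem hVmem hv)) hf)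
  obtain ⟨_, ⟨φ, rfl⟩, hφ⟩ := Metric.mem_closure_iff.1
    (ContinuousMap.toLp_denseRange ℂ μ ℂ (p := 2) (by simp) f) (‖f‖ / 4) (by positivity)
  rw [dist_eq_norm] at hφ
  obtain ⟨C, hC0, hC⟩ := hρ.exists_norm_sub_sq_le φ (δ := ‖f‖ ^ 2 / 16) (by positivity)
  set ε : ℝ := ‖f‖ ^ 2 / 16 / (C + ‖φ‖ ^ 2 + 1) with hεdef
  have hε : 0 < ε := by positivity
  have hε' : C * (ε / 2) + ‖φ‖ ^ 2 * ε ≤ ‖f‖ ^ 2 / 16 := by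
    have h1 : ε * (C + ‖φ‖ ^ 2 + 1) = ‖f‖ ^ 2 / 16 := div_mul_cancel₀ _ (by positivity)
    have : 0 ≤ C * ε := by positivity
    nlinarith
  obtain ⟨M, hM⟩ := h ε hε
  have hbound : ∀ n, ‖f‖ ^ 2 / 2 ≤ M * ‖Finsupp.linearCombination ℂ
      (fun g => InnerProductSpace.rankOne ℂ (koopmanIsometry μ g f) (koopmanIsometry μ g f))
      (uniformWeight ℂ (F n))‖ := by
    intro n
    obtain ⟨m, hm, x, hx⟩ := complexity_le_iff.1 (hM n)
    obtain ⟨V, hVfd, hVm, v, hvV, hv⟩ := exists_stepFunctions (μ := μ) hρ.1 (F n) (hF.nonempty n) φ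
      (by positivity) hC0 hε hC x hx
    have h1 := sum_norm_sq_le_of_mem (F n) (hF.nonempty n) (fun g => koopmanIsometry μ g f) v V hvV
    set t := ‖Finsupp.linearCombination ℂ
      (fun g => InnerProductSpace.rankOne ℂ (koopmanIsometry μ g f) (koopmanIsometry μ g f))
      (uniformWeight ℂ (F n))‖ with ht
    have hc : (0 : ℝ) < (F n).card := by exact_mod_cast (hF.nonempty n).card_pos
    have h2 : ∀ g, ‖koopmanIsometry μ g f - v g‖ ^ 2 ≤
        ‖f‖ ^ 2 / 8 + 2 * ‖koopman μ g (φ.toLp 2 μ ℂ) - v g‖ ^ 2 := by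
      intro g
      have h3 : ‖koopmanIsometry μ g f - v g‖ ≤
          ‖f‖ / 4 + ‖koopman μ g (φ.toLp 2 μ ℂ) - v g‖ := by
        have h4 : ‖koopmanIsometry μ g f - koopmanIsometry μ g (φ.toLp 2 μ ℂ)‖ ≤ ‖f‖ / 4 := by
          rw [← map_sub, LinearIsometry.norm_map]
          exact hφ.le
        exact (norm_sub_le_norm_sub_add_norm_sub _ (koopman μ g (φ.toLp 2 μ ℂ)) _).trans
          (add_le_add h4 le_rfl)
      have h5 := pow_le_pow_left₀ (norm_nonneg _) h3 2
      nlinarith [sq_nonneg (‖f‖ / 4 - ‖koopman μ g (φ.toLp 2 μ ℂ) - v g‖)]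
    -- `3/8 = 1/8 + 2 (1/16 + 1/16)`: replacing `f` by `φ`, then `δ` and the `ε` terms of the step
    -- function estimate.
    have h3 : ∑ g ∈ F n, ‖koopmanIsometry μ g f - v g‖ ^ 2 ≤ (F n).card * (‖f‖ ^ 2 * (3 / 8)) := by
      refine (Finset.sum_le_sum fun g _ => h2 g).trans ?_
      rw [Finset.sum_add_distrib, ← Finset.mul_sum, Finset.sum_const, nsmul_eq_mul]
      nlinarith
    simp only [LinearIsometry.norm_map, Finset.sum_const, nsmul_eq_mul] at h1
    have h4 : (Module.finrank ℂ V : ℝ) * t ≤ M * t := by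
      gcongr
      exact_mod_cast hVm.trans hm
    have h5 : ((F n).card : ℝ) * ‖f‖ ^ 2 ≤ (F n).card * (‖f‖ ^ 2 * (3 / 8) + M * t) := by
      rw [mul_add]
      exact h1.trans (add_le_add h3 (by gcongr))
    have := le_of_mul_le_mul_left h5 hc
    linarith
  have h0 := hlim.norm.const_mul (M : ℝ)
  rw [norm_zero, mul_zero] at h0
  have := ge_of_tendsto' h0 hbound
  linarith

end Main

/-! ### Discrete spectrum implies bounded complexity -/

section Orbits

variable {G X : Type*} [Group G] [MulAction G X] [MeasurableSpace X] [MeasurableConstSMul G X]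
  {μ : Measure X} [SMulInvariantMeasure G X μ]

lemma exists_finset_norm_koopman_sub_lt_of_mem {V : Submodule ℂ (Lp ℂ 2 μ)}
    [FiniteDimensional ℂ V] (hV : ∀ g : G, ∀ f ∈ V, koopman μ g f ∈ V) {f : Lp ℂ 2 μ} (hf : f ∈ V)
    {ε : ℝ} (hε : 0 < ε) :
    ∃ s : Finset G, ∀ g : G, ∃ j ∈ s, ‖koopman μ g f - koopman μ j f‖ < ε := by
  classical
  have hproper : ProperSpace V := FiniteDimensional.proper ℂ V
  have hb : TotallyBounded (Set.range fun g : G => (⟨koopman μ g f, hV g f hf⟩ : V)) := by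
    refine (isCompact_closedBall (0 : V) ‖f‖).totallyBounded.subset ?_
    rintro _ ⟨g, rfl⟩
    rw [mem_closedBall_zero_iff]
    exact ((koopmanIsometry μ g).norm_map f).le
  obtain ⟨t, ht, htf, hcov⟩ := Metric.finite_approx_of_totallyBounded hb ε hε
  choose! j hj using fun y (hy : y ∈ t) => ht hy
  refine ⟨htf.toFinset.image j, fun g => ?_⟩
  obtain ⟨y, hy, hgy⟩ := Set.mem_iUnion₂.1 (hcov ⟨g, rfl⟩)
  refine ⟨j y, Finset.mem_image_of_mem _ (htf.mem_toFinset.2 hy), ?_⟩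
  rw [← hj y hy, Metric.mem_ball, dist_eq_norm] at hgy
  exact hgy

/-- If `μ` has discrete spectrum, then the orbits of the Koopman operators are totally bounded. -/
lemma HasDiscreteSpectrum.exists_finset_norm_koopman_sub_lt (h : HasDiscreteSpectrum G μ)
    (f : Lp ℂ 2 μ) {ε : ℝ} (hε : 0 < ε) :
    ∃ s : Finset G, ∀ g : G, ∃ j ∈ s, ‖koopman μ g f - koopman μ j f‖ < ε := by
  set 𝒱 : Set (Submodule ℂ (Lp ℂ 2 μ)) := {V : Submodule ℂ (Lp ℂ 2 μ) |
    FiniteDimensional ℂ V ∧ ∀ g : G, ∀ f ∈ V, koopman μ g f ∈ V}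
  have hne : 𝒱.Nonempty := ⟨⊥, inferInstance, fun g f hf => by
    rw [Submodule.mem_bot] at hf ⊢
    rw [hf, map_zero]⟩
  -- Directedness puts each vector of the supremum into a single finite-dimensional invariant
  -- subspace, where bounded orbits are totally bounded.
  have hdir : DirectedOn (· ≤ ·) 𝒱 := by
    rintro V ⟨hV, hVi⟩ W ⟨hW, hWi⟩
    refine ⟨V ⊔ W, ⟨inferInstance, fun g f hf => ?_⟩, le_sup_left, le_sup_right⟩
    obtain ⟨v, hv, w, hw, rfl⟩ := Submodule.mem_sup.1 hf
    rw [map_add]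
    exact Submodule.add_mem_sup (hVi g v hv) (hWi g w hw)
  have hf : f ∈ (sSup 𝒱).topologicalClosure := by
    have : f ∈ discreteSpectrumSubspace G μ := by
      rw [show discreteSpectrumSubspace G μ = ⊤ from h]
      trivial
    exact this
  rw [← SetLike.mem_coe, Submodule.topologicalClosure_coe, Metric.mem_closure_iff] at hf
  obtain ⟨f', hf', hff'⟩ := hf (ε / 3) (by positivity)
  obtain ⟨V, ⟨hV, hVi⟩, hfV⟩ := (Submodule.mem_sSup_of_directed hne hdir).1 hf'
  obtain ⟨s, hs⟩ := exists_finset_norm_koopman_sub_lt_of_mem hVi hfV (ε := ε / 3) (by positivity)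
  refine ⟨s, fun g => ?_⟩
  obtain ⟨j, hj, hgj⟩ := hs g
  refine ⟨j, hj, ?_⟩
  have hk : ∀ k : G, ‖koopman μ k f - koopman μ k f'‖ < ε / 3 := fun k => by
    rw [← dist_eq_norm]
    exact ((koopmanIsometry μ k).dist_map f f').trans_lt hff'
  have h1 := norm_sub_le_norm_sub_add_norm_sub (koopman μ g f) (koopman μ g f') (koopman μ j f)
  have h2 := norm_sub_le_norm_sub_add_norm_sub (koopman μ g f') (koopman μ j f') (koopman μ j f)
  have h3 := hk j
  rw [norm_sub_rev] at h3
  linarith [hk g]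

end Orbits

/-- A continuous semimetric on a compact space is, up to `δ`, bounded by the variation of finitely
many continuous functions. -/
lemma IsContinuousSemimetric.exists_le_sum {X : Type*} [TopologicalSpace X] [CompactSpace X]
    {ρ : X → X → ℝ} (hρ : IsContinuousSemimetric ρ) {δ : ℝ} (hδ : 0 < δ) :
    ∃ (Z : Finset X) (φ : X → C(X, ℂ)), ∀ x y, ρ x y ≤ δ + ∑ z ∈ Z, ‖φ z x - φ z y‖ := by
  have hc := hρ.continuous
  obtain ⟨hs, -⟩ := hρ
  have hcz : ∀ z, Continuous (ρ z) := fun z => hc.comp (continuous_const.prodMk continuous_id)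
  -- The functions are `ρ z` for `z` in a finite `δ / 2`-net: `ρ x y ≤ ρ z x + ρ z y ≤ 2 ρ z x + |ρ
  -- z x - ρ z y|`.
  obtain ⟨Z, hZ⟩ := isCompact_univ.elim_finite_subcover (fun z => {x | ρ z x < δ / 2})
    (fun z => isOpen_lt (hcz z) continuous_const)
    (fun x _ => Set.mem_iUnion.2 ⟨x, by simpa [hs.self] using hδ⟩)
  refine ⟨Z, fun z => ⟨fun x => (ρ z x : ℂ), Complex.continuous_ofReal.comp (hcz z)⟩,
    fun x y => ?_⟩
  obtain ⟨z, hz, hzx⟩ := Set.mem_iUnion₂.1 (hZ (Set.mem_univ x))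
  have h1 : ρ z x < δ / 2 := hzx
  have h2 : |ρ z x - ρ z y| ≤ ∑ z ∈ Z, ‖((ρ z x : ℂ) - (ρ z y : ℂ))‖ := by
    have := Finset.single_le_sum (f := fun z => ‖((ρ z x : ℂ) - (ρ z y : ℂ))‖)
      (fun _ _ => norm_nonneg _) hz
    rwa [← Complex.ofReal_sub, Complex.norm_real, Real.norm_eq_abs] at this
  have h3 := hs.triangle x z y
  rw [hs.symm x z] at h3
  have h4 := neg_abs_le (ρ z x - ρ z y)
  simp only [ContinuousMap.coe_mk]
  linarith

section Main

variable {G X : Type*} [Group G] [MetricSpace X] [CompactSpace X] [MeasurableSpace X]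
  [BorelSpace X] [MulAction G X] [ContinuousConstSMul G X] {μ : Measure X} [IsProbabilityMeasure μ]

lemma integrable_of_continuous {f : X → ℝ} (hf : Continuous f) : Integrable f μ :=
  hf.integrable_of_hasCompactSupport (HasCompactSupport.of_compactSpace f)

lemma HasDiscreteSpectrum.exists_finset_integral_le [SMulInvariantMeasure G X μ]
    (h : HasDiscreteSpectrum G μ) (φ : C(X, ℂ)) {η : ℝ} (hη : 0 < η) :
    ∃ s : Finset G, ∀ g : G, ∃ j ∈ s, ∫ x, ‖φ (g • x) - φ (j • x)‖ ∂μ ≤ η := by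
  obtain ⟨s, hs⟩ := h.exists_finset_norm_koopman_sub_lt (φ.toLp 2 μ ℂ) (ε := η / 2) (by positivity)
  refine ⟨s, fun g => ?_⟩
  obtain ⟨j, hj, hgj⟩ := hs g
  refine ⟨j, hj, ?_⟩
  have hae : ∀ k : G, koopman μ k (φ.toLp 2 μ ℂ) =ᵐ[μ] fun x => φ (k • x) := fun k => by
    filter_upwards [coeFn_koopman μ k (φ.toLp 2 μ ℂ),
      (measurePreserving_smul k μ).quasiMeasurePreserving.ae
        (ContinuousMap.coeFn_toLp (p := 2) (𝕜 := ℂ) μ φ)] with x h1 h2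
    rw [h1, h2]
  have hsq : ∫ x, ‖φ (g • x) - φ (j • x)‖ ^ 2 ∂μ ≤ (η / 2) ^ 2 := by
    have : ‖koopman μ g (φ.toLp 2 μ ℂ) - koopman μ j (φ.toLp 2 μ ℂ)‖ ^ 2 =
        ∫ x, ‖φ (g • x) - φ (j • x)‖ ^ 2 ∂μ := by
      rw [Lp_norm_sq_eq_integral]
      refine integral_congr_ae ?_
      filter_upwards [Lp.coeFn_sub (koopman μ g (φ.toLp 2 μ ℂ)) (koopman μ j (φ.toLp 2 μ ℂ)),
        hae g, hae j] with x h1 h2 h3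
      rw [h1, Pi.sub_apply, h2, h3]
    rw [← this]
    exact pow_le_pow_left₀ (norm_nonneg _) hgj.le 2
  have hc : Continuous fun x => ‖φ (g • x) - φ (j • x)‖ := by fun_prop
  have hi : Integrable (fun x => ‖φ (g • x) - φ (j • x)‖ ^ 2) μ :=
    integrable_of_continuous (hc.pow 2)
  -- An `L²` bound yields an `L¹` bound through `2a ≤ η/2 + (2/η) a²`.
  calc ∫ x, ‖φ (g • x) - φ (j • x)‖ ∂μ
      ≤ ∫ x, (η / 2 + (2 / η) * ‖φ (g • x) - φ (j • x)‖ ^ 2) ∂μ := by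
        refine integral_mono (integrable_of_continuous hc)
          ((integrable_const _).add (hi.const_mul _)) fun x => ?_
        have h1 : 0 ≤ 2 / η * (‖φ (g • x) - φ (j • x)‖ - η / 2) ^ 2 := by positivity
        have h2 : 2 / η * (‖φ (g • x) - φ (j • x)‖ - η / 2) ^ 2 =
            η / 2 + (2 / η) * ‖φ (g • x) - φ (j • x)‖ ^ 2 - 2 * ‖φ (g • x) - φ (j • x)‖ := by
          field_simp
          ring
        have := norm_nonneg (φ (g • x) - φ (j • x))
        change ‖φ (g • x) - φ (j • x)‖ ≤ η / 2 + (2 / η) * ‖φ (g • x) - φ (j • x)‖ ^ 2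
        linarith
    _ = η / 2 + (2 / η) * ∫ x, ‖φ (g • x) - φ (j • x)‖ ^ 2 ∂μ := by
        rw [integral_add (integrable_const _) (hi.const_mul _), integral_const_mul]
        simp
    _ ≤ η / 2 + (2 / η) * (η / 2) ^ 2 := by gcongr
    _ = η := by field_simp; ring

theorem HasDiscreteSpectrum.hasBoundedComplexity [SMulInvariantMeasure G X μ]
    (h : HasDiscreteSpectrum G μ) {F : ℕ → Finset G} (hF : ∀ n, (F n).Nonempty) {ρ : X → X → ℝ}
    (hρ : IsContinuousSemimetric ρ) : HasBoundedComplexity μ F ρ := by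
  intro ε hε
  obtain ⟨Z, φ, hφ⟩ := hρ.exists_le_sum (δ := ε / 16) (by positivity)
  -- The extra `1` keeps `c` positive when `Z` is empty.
  set c : ℝ := Z.card + 1 with hc
  have hcpos : 0 < c := by positivity
  have hZc : (Z.card : ℝ) ≤ c := by simp [hc]
  choose s hs using fun z => h.exists_finset_integral_le (φ z)
    (η := ε / 16 * (ε / 2) / c) (by positivity)
  choose J hJs hJ using hs
  have hO : ∀ p, IsOpen (⋂ z ∈ Z, ⋂ j ∈ s z, {y | ‖φ z (j • p) - φ z (j • y)‖ < ε / 32 / c}) := by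
    intro p
    refine isOpen_biInter_finset fun z _ => isOpen_biInter_finset fun j _ => ?_
    exact isOpen_lt (by fun_prop) continuous_const
  -- Only the finitely many `φ z ∘ j` with `j ∈ s z` enter, so the resulting cover, and with it the
  -- bound `t.card`, is independent of `n`.
  set O : X → Set X := fun p =>
    ⋂ z ∈ Z, ⋂ j ∈ s z, {y | ‖φ z (j • p) - φ z (j • y)‖ < ε / 32 / c} with hOdef
  obtain ⟨t, ht⟩ := isCompact_univ.elim_finite_subcover O hO (fun p _ => Set.mem_iUnion.2
    ⟨p, by simp only [hOdef, Set.mem_iInter, Set.mem_ofPred_eq, sub_self, norm_zero]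
           intros; positivity⟩)
  refine ⟨t.card, fun n => complexity_le_iff.2 ⟨t.card, le_rfl, ?_⟩⟩
  have hcard : (0 : ℝ) < (F n).card := by exact_mod_cast (hF n).card_pos
  set E : X → ℝ := fun x => (1 / ((F n).card : ℝ)) *
    ∑ g ∈ F n, ∑ z ∈ Z, ‖φ z (g • x) - φ z (J z g • x)‖ with hE
  have hEc : Continuous E := by fun_prop
  have hE0 : ∀ x, 0 ≤ E x := fun x => by positivity
  have hEint : ∫ x, E x ∂μ ≤ ε / 16 * (ε / 2) := by
    have hi : ∀ g z, Integrable (fun x => ‖φ z (g • x) - φ z (J z g • x)‖) μ := fun g z =>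
      integrable_of_continuous (by fun_prop)
    rw [hE, integral_const_mul,
      integral_finsetSum _ fun g _ => integrable_finsetSum _ fun z _ => hi g z]
    have h1 : ∑ g ∈ F n, ∫ x, ∑ z ∈ Z, ‖φ z (g • x) - φ z (J z g • x)‖ ∂μ ≤
        ∑ _g ∈ F n, ε / 16 * (ε / 2) := by
      refine Finset.sum_le_sum fun g _ => ?_
      rw [integral_finsetSum _ fun z _ => hi g z]
      refine (Finset.sum_le_sum fun z _ => hJ z g).trans ?_
      rw [Finset.sum_const, nsmul_eq_mul, mul_div_assoc', div_le_iff₀ hcpos, mul_comm]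
      gcongr
    rw [Finset.sum_const, nsmul_eq_mul] at h1
    rw [one_div, inv_mul_le_iff₀ hcard]
    exact h1
  -- `E` is the mean error of replacing `g` by `J z g`. By Markov's inequality the complement of `K`
  -- has measure at most `ε / 2`.
  set K : Set X := {x | E x < ε / 16} with hK
  have hKm : MeasurableSet K := (isOpen_lt hEc continuous_const).measurableSet
  have hKμ : 1 - ε < μ.real K := by
    have h1 := mul_meas_ge_le_integral_of_nonneg (Eventually.of_forall hE0)
      (integrable_of_continuous (μ := μ) hEc) (ε / 16)
    have h2 : {x | ε / 16 ≤ E x} = Kᶜ := by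
      ext x
      simp [hK]
    rw [h2, probReal_compl_eq_one_sub hKm] at h1
    have := le_of_mul_le_mul_left (h1.trans hEint) (by positivity)
    linarith
  classical
  -- Centres must lie in `K` for their own error to be small. If `O p` misses `K`, the centre `p` is
  -- a dummy whose ball is never needed.
  refine ⟨fun i => if hi : (K ∩ O (t.equivFin.symm i)).Nonempty then hi.choose
    else t.equivFin.symm i, hKμ.trans_le (measureReal_mono fun y hy => ?_)⟩
  obtain ⟨p, hpt, hyp⟩ := Set.mem_iUnion₂.1 (ht (Set.mem_univ y))
  refine Set.mem_iUnion.2 ⟨t.equivFin ⟨p, hpt⟩, ?_⟩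
  simp only [Equiv.symm_apply_apply, Set.mem_ofPred_eq]
  have hne : (K ∩ O p).Nonempty := ⟨y, hy, hyp⟩
  rw [dif_pos hne]
  obtain ⟨hqK, hqO⟩ := hne.choose_spec
  set q := hne.choose
  have hqy : ∀ z ∈ Z, ∀ j ∈ s z, ‖φ z (j • q) - φ z (j • y)‖ ≤ ε / 16 / c := by
    intro z hz j hj
    simp only [hOdef, Set.mem_iInter, Set.mem_ofPred_eq] at hqO hyp
    have h1 := hqO z hz j hj
    have h2 := hyp z hz j hj
    have h3 := norm_sub_le_norm_sub_add_norm_sub (φ z (j • q)) (φ z (j • p)) (φ z (j • y))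
    rw [norm_sub_rev] at h1
    have h4 : ε / 16 / c = ε / 32 / c + ε / 32 / c := by ring
    linarith
  have hterm : ∀ g, ρ (g • q) (g • y) ≤ ε / 8 +
      (∑ z ∈ Z, ‖φ z (g • q) - φ z (J z g • q)‖ + ∑ z ∈ Z, ‖φ z (g • y) - φ z (J z g • y)‖) := by
    intro g
    have h1 : ∑ z ∈ Z, ‖φ z (g • q) - φ z (g • y)‖ ≤ ∑ z ∈ Z, (ε / 16 / c +
        (‖φ z (g • q) - φ z (J z g • q)‖ + ‖φ z (g • y) - φ z (J z g • y)‖)) := by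
      refine Finset.sum_le_sum fun z hz => ?_
      have h2 := norm_sub_le_norm_sub_add_norm_sub (φ z (g • q)) (φ z (J z g • q)) (φ z (g • y))
      have h3 := norm_sub_le_norm_sub_add_norm_sub (φ z (J z g • q)) (φ z (J z g • y)) (φ z (g • y))
      rw [norm_sub_rev (φ z (J z g • y)) (φ z (g • y))] at h3
      linarith [hqy z hz _ (hJs z g)]
    rw [Finset.sum_add_distrib, Finset.sum_add_distrib, Finset.sum_const, nsmul_eq_mul] at h1
    have h4 : (Z.card : ℝ) * (ε / 16 / c) ≤ ε / 16 := by
      rw [mul_div_assoc', div_le_iff₀ hcpos, mul_comm]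
      gcongr
    linarith [hφ (g • q) (g • y)]
  -- The total is below `ε/8 + ε/16 + ε/16 = ε/4`, within the required `ε/2`.
  have havg : averageSemimetric ρ (F n) q y ≤ ε / 8 + (E q + E y) := by
    rw [averageSemimetric]
    refine (mul_le_mul_of_nonneg_left (Finset.sum_le_sum fun g _ => hterm g)
      (by positivity)).trans (le_of_eq ?_)
    rw [Finset.sum_add_distrib, Finset.sum_add_distrib, Finset.sum_const, nsmul_eq_mul]
    simp only [hE]
    field_simp
  have hqK' : E q < ε / 16 := hqK
  have hyK' : E y < ε / 16 := hy
  linarith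

end Main

end

theorem mainTheorem5 {G X : Type*} [Group G] [Countable G] [Infinite G]
    [MetricSpace X] [CompactSpace X] [MeasurableSpace X] [BorelSpace X]
    [MulAction G X] [ContinuousConstSMul G X]
    (μ : Measure X) [IsProbabilityMeasure μ] [SMulInvariantMeasure G X μ]
    (F : ℕ → Finset G) (hF : IsFolnerSequence F) :
    List.TFAE [
      HasDiscreteSpectrum G μ,
      ∃ d' : X → X → ℝ, IsContinuousMetric d' ∧ HasBoundedComplexity μ F d',
      ∀ ρ : X → X → ℝ, IsContinuousSemimetric ρ → HasBoundedComplexity μ F ρ,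
      HasBoundedComplexity μ F (fun x y : X => dist x y)] := by
  tfae_have 1 → 3 := fun h ρ hρ => h.hasBoundedComplexity hF.nonempty hρ
  tfae_have 3 → 4 := fun h => h _ isContinuousMetric_dist.1
  tfae_have 4 → 2 := fun h => ⟨_, isContinuousMetric_dist, h⟩
  tfae_have 2 → 1 := fun ⟨_, hd, h⟩ => h.hasDiscreteSpectrum hF hd
  tfae_finish
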